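/- A *convex body* is a bounded convex set $C\subset\mathbb{R}^2$ with non-empty interior. For an angle $\theta\in\mathbb{R}/2\pi\mathbb{Z}$ put $\mathbf u(\theta)=(\cos\theta,\sin\theta)$, and for $\lambda\ge 0$ let $$K_C(\theta,\lambda)=\Big\{\mathbf x\in C:\ \mathbf x\cdot\mathbf u(\theta)=\inf_{\mathbf y\in C}\mathbf y\cdot\mathbf u(\theta)+\lambda\Big\}$$ be the chord of $C$ in direction $\mathbf u(\theta)$ at distance $\lambda$, with length $|K_C(\theta,\lambda)|$. Put $$\gamma_C(\theta,\lambda)=\max\{|K_C(\theta,\lambda)|,|K_C(\theta+\pi,\lambda)|\},\qquad L_C=\sup_{\mathbf x,\mathbf y\in C}|\mathbf x-\mathbf y|,\qquad S_C=\inf_{\theta}\ \sup_{\lambda\ge 0}|K_C(\theta,\lambda)|.$$ For a bounded set $\Omega\subset\mathbb{R}^2$ let $\widehat{\mathbf 1}_\Omega(\boldsymbol\xi)=\int_\Omega e^{-2\pi i\,\mathbf x\cdot\boldsymbol\xi}\,d\mathbf x$, and let $\delta C=\{\delta\mathbf x:\mathbf x\in C\}$ for $\delta\ge 0$. **Lemma.**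 There exist positive absolute constants $\kappa_3,\kappa_4$ such that, for every convex body $C\subset\mathbb{R}^2$, every angle $\theta\in\mathbb{R}/2\pi\mathbb{Z}$ and every real $\rho\ge\kappa_3L_C^6/S_C^7$, the function $\delta\mapsto|\widehat{\mathbf 1}_{\delta C}(\rho\,\mathbf u(\theta))|^2$ is integrable on $[0,1]$ and $$\kappa_4\,\rho^{-2}\gamma_C(\theta,\rho^{-1})^2\ \le\ \int_0^1\big|\widehat{\mathbf 1}_{\delta C}(\rho\,\mathbf u(\theta))\big|^2\,d\delta\ \le\ 2\,\rho^{-2}\gamma_C(\theta,\rho^{-1})^2 .$$ -/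

import Mathlib

open scoped Pointwise FourierTransform RealInnerProductSpace

noncomputable section

namespace PlanarBody

/-- The Euclidean plane. -/
abbrev Plane : Type := EuclideanSpace ℝ (Fin 2)

/-- A planar convex body: a bounded convex subset of the plane with non-empty interior. -/
structure IsConvexBody (C : Set Plane) : Prop where
  convex : Convex ℝ C
  isBounded : Bornology.IsBounded C
  interior_nonempty : (interior C).Nonempty

/-- The unit vector `(cos θ, sin θ)`, for an angle `θ` in `ℝ / 2πℤ`. -/
def u (θ : Real.Angle) : Plane := !₂[θ.cos, θ.sin]

/-- The chord of `C` in direction `u θ` at distance `l` from the supporting line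
`x · u θ = inf_{y ∈ C} y · u θ`. -/
def chord (C : Set Plane) (θ : Real.Angle) (l : ℝ) : Set Plane :=
  {x | x ∈ C ∧ ⟪x, u θ⟫ = (⨅ y : C, ⟪(y : Plane), u θ⟫) + l}

/-- The length of the chord. A chord of a convex set is a (possibly empty) line segment, with or
without its endpoints, so that its length is its diameter. -/
def chordLength (C : Set Plane) (θ : Real.Angle) (l : ℝ) : ℝ :=
  Metric.diam (chord C θ l)

/-- The longer of the two chords at distance `l` in the directions `θ` and `θ + π`. -/
def gamma (C : Set Plane) (θ : Real.Angle) (l : ℝ) : ℝ :=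
  max (chordLength C θ l) (chordLength C (θ + (Real.pi : Real.Angle)) l)

/-- The longest directional diameter, that is, the usual diameter. -/
def longDiam (C : Set Plane) : ℝ := Metric.diam C

/-- The shortest directional diameter: the least, over all directions, of the length of the
longest chord in that direction. -/
def shortDiam (C : Set Plane) : ℝ :=
  ⨅ θ : Real.Angle, ⨆ l : {l : ℝ // 0 ≤ l}, chordLength C θ l

/-- The Fourier transform `ξ ↦ ∫_Ω exp (-2πi x · ξ) dx` of the indicator function of `Ω`. -/
def indicatorFourier (Ω : Set Plane) (ξ : Plane) : ℂ :=
  𝓕 (Ω.indicator (fun _ => (1 : ℂ))) ξ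

end PlanarBody

end

open scoped Pointwise FourierTransform RealInnerProductSpace

open MeasureTheory Set

noncomputable section

namespace PlanarBody

/-! Slicing `C` by the lines orthogonal to `u θ` turns the problem into one about a function `f` on
the line: the chord length, concave on `(0, w)`, with `w` the width of `C`. Up to a phase the
transform of `C` at `s • u θ` is that of `f` at `s`, so by scaling the integral is that of `(s²
|f̂(sρ)|)²` over `[0, 1]`. Write `l = ρ⁻¹` and `G = max (f l) (f (w - l))`; the argument needs only
`10 * l ≤ w`.

Upper bound, pointwise in `s`: for `h = 1/(2sρ)` the second difference of `f` with step `h` has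
transform `-4 f̂(sρ)`. It has mean zero, and by concavity it is positive only near the two ends,
where values of `f` bound it; this controls its `L¹` norm (`norm_lineFourier_le_of_step`).

Lower bound: by Cauchy–Schwarz it suffices to bound the integral of `s² |f̂(sρ)|` below. Testing
against `s² (1 - s)³` with a linear phase gives the integral of `f` against a kernel that is
positive on the support of `f`, because the cosine transform of the weight is negative for arguments
at least 12 (`integral_mul_cos_le`). The part over `[l, 2l]` yields `f l`, and reflection yields `f
(w - l)`. -/

/-- A nonnegative integrable function on the line that is concave on `(0, w)` and vanishes off this
interval. -/
structure IsConcaveProfile (w : ℝ) (f : ℝ → ℝ) : Prop where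
  concave : ConcaveOn ℝ (Ioo 0 w) f
  nonneg : ∀ t, 0 ≤ f t
  eq_zero : ∀ t, t ∉ Ioo 0 w → f t = 0
  integrable : Integrable f

/-! ### Fourier transforms of integrable functions on the line -/

/-- The Fourier transform of a real function on the line. -/
def lineFourier (f : ℝ → ℝ) (s : ℝ) : ℂ :=
  ∫ t, (f t : ℂ) * Complex.exp (-(2 * Real.pi * s * t : ℝ) * Complex.I)

theorem norm_exp_neg_ofReal_mul_I (x : ℝ) : ‖Complex.exp (-(x : ℂ) * Complex.I)‖ = 1 := by
  rw [← Complex.ofReal_neg, Complex.norm_exp_ofReal_mul_I]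

theorem integrable_mul_exp {f : ℝ → ℝ} (hf : Integrable f) (s : ℝ) :
    Integrable fun t => (f t : ℂ) * Complex.exp (-(2 * Real.pi * s * t : ℝ) * Complex.I) := by
  refine hf.ofReal.mul_bdd (c := 1) (Continuous.aestronglyMeasurable (by fun_prop)) ?_
  exact Filter.Eventually.of_forall fun t => (norm_exp_neg_ofReal_mul_I _).le

theorem norm_lineFourier_le (f : ℝ → ℝ) (s : ℝ) : ‖lineFourier f s‖ ≤ ∫ t, |f t| := by
  refine (norm_integral_le_integral_norm _).trans (le_of_eq ?_)
  congr 1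
  ext t
  rw [norm_mul, norm_exp_neg_ofReal_mul_I, mul_one, Complex.norm_real, Real.norm_eq_abs]

theorem continuous_lineFourier {f : ℝ → ℝ} (hf : Integrable f) : Continuous (lineFourier f) := by
  refine continuous_of_dominated (bound := fun t => ‖f t‖)
    (fun s => (integrable_mul_exp hf s).aestronglyMeasurable) ?_ hf.norm ?_
  · intro s
    refine Filter.Eventually.of_forall fun t => ?_
    rw [norm_mul, norm_exp_neg_ofReal_mul_I, mul_one, Complex.norm_real]
  · exact Filter.Eventually.of_forall fun t => by fun_prop

theorem lineFourier_comp_add (f : ℝ → ℝ) (a s : ℝ) :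
    lineFourier (fun t => f (t + a)) s =
      Complex.exp ((2 * Real.pi * s * a : ℝ) * Complex.I) * lineFourier f s := by
  unfold lineFourier
  rw [← integral_const_mul, ← integral_add_right_eq_self (μ := volume) (fun t : ℝ =>
    Complex.exp ((2 * Real.pi * s * a : ℝ) * Complex.I) *
      ((f t : ℂ) * Complex.exp (-(2 * Real.pi * s * t : ℝ) * Complex.I))) a]
  congr 1
  ext t
  rw [mul_left_comm, ← Complex.exp_add]
  congr 2
  push_cast
  ring

/-- Reflection conjugates the transform up to a phase, so estimates at the left end carry over to
the right end. -/
theorem norm_lineFourier_comp_sub_left (f : ℝ → ℝ) (w s : ℝ) :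
    ‖lineFourier (fun t => f (w - t)) s‖ = ‖lineFourier f s‖ := by
  have h : lineFourier (fun t => f (w - t)) s =
      Complex.exp (-(2 * Real.pi * s * w : ℝ) * Complex.I) *
        (starRingEnd ℂ) (lineFourier f s) := by
    unfold lineFourier
    rw [← integral_conj, ← integral_const_mul,
      ← integral_sub_left_eq_self _ volume w]
    congr 1
    ext t
    rw [map_mul, Complex.conj_ofReal, ← Complex.exp_conj, mul_left_comm, ← Complex.exp_add]
    congr 2
    · simp only [sub_sub_cancel]
    · simp only [map_mul, map_neg, Complex.conj_ofReal, Complex.conj_I]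
      push_cast
      ring
  rw [h, norm_mul, norm_exp_neg_ofReal_mul_I, one_mul, RCLike.norm_conj]

/-! ### Concave profiles and the upper bound -/

namespace IsConcaveProfile

variable {w : ℝ} {f : ℝ → ℝ}

theorem reflect (hf : IsConcaveProfile w f) : IsConcaveProfile w fun t => f (w - t) where
  concave := by
    refine ⟨convex_Ioo 0 w, fun x hx y hy a b ha hb hab => ?_⟩
    have h := hf.concave.2 (x := w - x) (y := w - y) ⟨by linarith [hx.2], by linarith [hx.1]⟩
      ⟨by linarith [hy.2], by linarith [hy.1]⟩ ha hb hab
    refine h.trans (le_of_eq ?_)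
    congr 1
    simp only [smul_eq_mul]
    linear_combination w * hab
  nonneg t := hf.nonneg _
  eq_zero t ht := hf.eq_zero _ fun h => ht ⟨by linarith [h.2], by linarith [h.1]⟩
  integrable := hf.integrable.comp_sub_left w

/-- A nonnegative concave function has `f t / t` nonincreasing. Concavity is known only on the open
interval and `f` may jump at `0`, so the chord starts at `ε > 0` and `ε` tends to `0`. -/
theorem mul_le_mul_left_end (hf : IsConcaveProfile w f) {x y : ℝ} (hx : 0 < x) (hxy : x ≤ y)
    (hy : y < w) : x * f y ≤ y * f x := by
  have key : ∀ ε ∈ Ioo 0 x, (x - ε) * f y ≤ (y - ε) * f x := by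
    intro ε hε
    have hd : 0 < y - ε := by linarith [hε.2]
    have h := hf.concave.2 (show ε ∈ Ioo 0 w from ⟨hε.1, by linarith [hε.2]⟩)
      (show y ∈ Ioo 0 w from ⟨by linarith, hy⟩)
      (show 0 ≤ (y - x) / (y - ε) from div_nonneg (by linarith) hd.le)
      (show 0 ≤ (x - ε) / (y - ε) from div_nonneg (by linarith [hε.2]) hd.le)
      (by field_simp; ring)
    have e : (y - x) / (y - ε) * ε + (x - ε) / (y - ε) * y = x := by field_simp; ring
    simp only [smul_eq_mul] at h
    rw [e] at h
    have h1 : 0 ≤ (y - x) / (y - ε) * f ε :=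
      mul_nonneg (div_nonneg (by linarith) hd.le) (hf.nonneg _)
    have h2 : (x - ε) / (y - ε) * f y ≤ f x := by linarith
    rw [div_mul_eq_mul_div, div_le_iff₀ hd] at h2
    linarith
  have hm : Ioo 0 x ∈ nhdsWithin (0 : ℝ) (Ioi 0) := Ioo_mem_nhdsGT hx
  have t1 : Filter.Tendsto (fun ε : ℝ => (x - ε) * f y) (nhdsWithin 0 (Ioi 0))
      (nhds ((x - 0) * f y)) :=
    (Continuous.tendsto (by fun_prop) 0).mono_left nhdsWithin_le_nhds
  have t2 : Filter.Tendsto (fun ε : ℝ => (y - ε) * f x) (nhdsWithin 0 (Ioi 0))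
      (nhds ((y - 0) * f x)) :=
    (Continuous.tendsto (by fun_prop) 0).mono_left nhdsWithin_le_nhds
  simpa using le_of_tendsto_of_tendsto t1 t2 (Filter.eventually_of_mem hm key)

theorem mul_le_mul_right_end (hf : IsConcaveProfile w f) {x y : ℝ} (hx : 0 < x) (hxy : x ≤ y)
    (hy : y < w) : (w - y) * f x ≤ (w - x) * f y := by
  have h := hf.reflect.mul_le_mul_left_end (x := w - y) (y := w - x) (by linarith) (by linarith)
    (by linarith)
  simpa using h

theorem le_add (hf : IsConcaveProfile w f) {x y : ℝ} (hx : 0 < x) (hy : 0 < y)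
    (hxy : x + y < w) : f (x + y) ≤ f x + f y := by
  have h1 := hf.mul_le_mul_left_end hx (by linarith : x ≤ x + y) hxy
  have h2 := hf.mul_le_mul_left_end hy (by linarith : y ≤ x + y) hxy
  refine le_of_mul_le_mul_left ?_ (by linarith : 0 < x + y)
  linarith

/-- Near the left end the second difference is at most a multiple of the value at the step. -/
theorem second_difference_le_left (hf : IsConcaveProfile w f) {h c G t : ℝ} (h0 : 0 < h)
    (hw : 3 * h ≤ w) (hc : w ≤ c * (w - h)) (hG : f h ≤ G) (ht : t < h) (ht' : -h < t) :
    f (t + h) + f (t - h) - 2 * f t ≤ c * G := by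
  have hG0 : 0 ≤ G := (hf.nonneg h).trans hG
  have hc1 : 1 ≤ c := by
    by_contra! hlt
    nlinarith
  have hGc : G ≤ c * G := by nlinarith
  rw [hf.eq_zero (t - h) fun h' => by linarith [h'.1]]
  rcases le_or_gt t 0 with h1 | h1
  · rw [hf.eq_zero t fun h' => by linarith [h'.1]]
    have h2 := hf.mul_le_mul_right_end (x := t + h) (y := h) (by linarith) (by linarith)
      (by linarith)
    have h3 : f (t + h) * (w - h) ≤ c * G * (w - h) := by
      have h4 : (w - (t + h)) * f h ≤ w * G :=
        mul_le_mul (by linarith) hG (hf.nonneg _) (by linarith)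
      have h5 : w * G ≤ c * (w - h) * G := mul_le_mul_of_nonneg_right hc hG0
      linarith
    have := le_of_mul_le_mul_right h3 (by linarith)
    linarith
  · have h2 := hf.le_add h1 h0 (by linarith)
    linarith [hf.nonneg t]

/-- Where both `t - h` and `t + h` lie in `(0, w)`, concavity makes the second difference
nonpositive. At `t = h` and `t = w - h` one of them is an endpoint, where `f` vanishes, and
subadditivity takes over. -/
theorem second_difference_le (hf : IsConcaveProfile w f) {h c G t : ℝ} (h0 : 0 < h)
    (hw : 3 * h ≤ w) (hc : w ≤ c * (w - h)) (hG : f h ≤ G) (hG' : f (w - h) ≤ G) :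
    f (t + h) + f (t - h) - 2 * f t ≤
      (Ioo (-h) h ∪ Ioo (w - h) (w + h)).indicator (fun _ => c * G) t := by
  by_cases h1 : t ∈ Ioo (-h) h ∪ Ioo (w - h) (w + h)
  · rw [indicator_of_mem h1]
    rcases h1 with h1 | h1
    · exact hf.second_difference_le_left h0 hw hc hG h1.2 h1.1
    · have h2 := hf.reflect.second_difference_le_left h0 hw hc hG' (t := w - t)
        (by linarith [h1.1]) (by linarith [h1.2])
      have e1 : w - (w - t + h) = t - h := by ring
      have e2 : w - (w - t - h) = t + h := by ring
      have e3 : w - (w - t) = t := by ring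
      simp only [e1, e2, e3] at h2
      linarith
  · rw [indicator_of_notMem h1]
    simp only [mem_union, mem_Ioo, not_or, not_and, not_lt] at h1
    rcases le_or_gt t (-h) with h2 | h2
    · rw [hf.eq_zero (t + h) fun h' => by linarith [h'.1],
        hf.eq_zero (t - h) fun h' => by linarith [h'.1], hf.eq_zero t fun h' => by linarith [h'.1]]
      norm_num
    have h3 := h1.1 h2
    rcases le_or_gt (w + h) t with h4 | h4
    · rw [hf.eq_zero (t + h) fun h' => by linarith [h'.2],
        hf.eq_zero (t - h) fun h' => by linarith [h'.2], hf.eq_zero t fun h' => by linarith [h'.2]]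
      norm_num
    have h5 : t ≤ w - h := by
      by_contra! h6
      linarith [h1.2 h6]
    rcases eq_or_lt_of_le h3 with h6 | h6
    · subst h6
      rw [hf.eq_zero (h - h) fun h' => by linarith [h'.1]]
      have := hf.le_add h0 h0 (by linarith)
      linarith
    rcases eq_or_lt_of_le h5 with h7 | h7
    · subst h7
      rw [hf.eq_zero (w - h + h) fun h' => by linarith [h'.2]]
      have := hf.reflect.le_add h0 h0 (by linarith)
      have e : w - (h + h) = w - h - h := by ring
      rw [e] at this
      linarith
    have := hf.concave.2 (show t - h ∈ Ioo 0 w from ⟨by linarith, by linarith⟩)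
      (show t + h ∈ Ioo 0 w from ⟨by linarith, by linarith⟩) (show (0 : ℝ) ≤ 1 / 2 by norm_num)
      (show (0 : ℝ) ≤ 1 / 2 by norm_num) (by norm_num)
    have e : (1 / 2 : ℝ) • (t - h) + (1 / 2 : ℝ) • (t + h) = t := by
      simp only [smul_eq_mul]; ring
    rw [e] at this
    simp only [smul_eq_mul] at this
    linarith

/-- The second difference has mean zero, so its `L¹` norm is twice the integral of its positive
part, which lives on two intervals of length `2h`. Its transform at `1/(2h)` is `-4` times that of
`f`. -/
theorem norm_lineFourier_le_of_step (hf : IsConcaveProfile w f) {h c G : ℝ} (h0 : 0 < h)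
    (hw : 3 * h ≤ w) (hc : w ≤ c * (w - h)) (hG : f h ≤ G) (hG' : f (w - h) ≤ G) :
    ‖lineFourier f (1 / (2 * h))‖ ≤ 2 * h * c * G := by
  set D : ℝ → ℝ := fun t => f (t + h) + f (t - h) - 2 * f t with hD
  set B : ℝ → ℝ := (Ioo (-h) h ∪ Ioo (w - h) (w + h)).indicator (fun _ => c * G) with hB
  have i1 : Integrable fun t => f (t + h) := hf.integrable.comp_add_right h
  have i2 : Integrable fun t => f (t - h) := hf.integrable.comp_sub_right h
  have i3 : Integrable fun t => 2 * f t := hf.integrable.const_mul 2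
  have iD : Integrable D := (i1.add i2).sub i3
  have hc0 : 0 ≤ c := by
    by_contra! hlt
    nlinarith
  have hcG : 0 ≤ c * G := mul_nonneg hc0 ((hf.nonneg h).trans hG)
  have hfin : volume (Ioo (-h) h ∪ Ioo (w - h) (w + h)) < ⊤ :=
    measure_union_lt_top (by simp) (by simp)
  have iB : Integrable B :=
    (integrable_indicator_iff (measurableSet_Ioo.union measurableSet_Ioo)).2
      (integrableOn_const hfin.ne)
  have hD0 : ∫ t, D t = 0 := by
    have := integral_sub (i1.add i2) i3
    simp only [Pi.add_apply] at this
    rw [hD, this, integral_add i1 i2, integral_const_mul,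
      integral_add_right_eq_self (μ := volume) f h, integral_sub_right_eq_self (μ := volume) f h]
    ring
  have hBint : ∫ t, B t = 4 * h * (c * G) := by
    rw [hB, integral_indicator (measurableSet_Ioo.union measurableSet_Ioo), setIntegral_const,
      measureReal_union (disjoint_left.2 fun x hx hx' => by linarith [hx.2, hx'.1])
        measurableSet_Ioo (by simp) (by simp), Real.volume_real_Ioo_of_le (by linarith),
      Real.volume_real_Ioo_of_le (by linarith), smul_eq_mul]
    ring
  have habs : ∫ t, |D t| ≤ 8 * h * (c * G) := by
    -- The absolute value is `2 D⁺ - D`, and `D⁺ ≤ B` because `B` is nonnegative.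
    have h1 : ∀ t, |D t| ≤ 2 * B t - D t := by
      intro t
      have h2 : D t ≤ B t := hf.second_difference_le h0 hw hc hG hG'
      have h3 : 0 ≤ B t := indicator_nonneg (fun _ _ => hcG) t
      exact abs_le.2 ⟨by linarith, by linarith⟩
    calc ∫ t, |D t| ≤ ∫ t, (2 * B t - D t) :=
          integral_mono iD.abs ((iB.const_mul 2).sub iD) h1
      _ = 8 * h * (c * G) := by
          rw [integral_sub (iB.const_mul 2) iD, integral_const_mul, hBint, hD0]
          ring
  -- At this frequency a translation by `h` or `-h` multiplies the transform by `exp (±πi) = -1`.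
  have hfour : lineFourier D (1 / (2 * h)) = -4 * lineFourier f (1 / (2 * h)) := by
    have e1 := lineFourier_comp_add f h (1 / (2 * h))
    have e2 := lineFourier_comp_add f (-h) (1 / (2 * h))
    have a1 : 2 * Real.pi * (1 / (2 * h)) * h = Real.pi := by field_simp
    have a2 : 2 * Real.pi * (1 / (2 * h)) * -h = -Real.pi := by field_simp
    rw [a1, Complex.exp_pi_mul_I] at e1
    rw [a2, Complex.ofReal_neg, neg_mul, Complex.exp_neg, Complex.exp_pi_mul_I] at e2
    have e3 : lineFourier D (1 / (2 * h)) = lineFourier (fun t => f (t + h)) (1 / (2 * h)) +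
        lineFourier (fun t => f (t + -h)) (1 / (2 * h)) - 2 * lineFourier f (1 / (2 * h)) := by
      have j1 := integrable_mul_exp i1 (1 / (2 * h))
      have j2 := integrable_mul_exp i2 (1 / (2 * h))
      have j3 := (integrable_mul_exp hf.integrable (1 / (2 * h))).const_mul 2
      simp only [← sub_eq_add_neg]
      unfold lineFourier
      have := integral_sub (j1.add j2) j3
      simp only [Pi.add_apply] at this
      rw [← integral_const_mul, ← integral_add j1 j2, ← this]
      congr 1
      ext t
      simp only [hD]
      push_cast
      ring
    rw [e3, e1, e2]
    norm_num
    ring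
  have h4 := norm_lineFourier_le D (1 / (2 * h))
  rw [hfour, norm_mul] at h4
  norm_num at h4 ⊢
  linarith

theorem apply_mul_le (hf : IsConcaveProfile w f) {l G t : ℝ} (l0 : 0 < l) (hlw : 3 * l ≤ w)
    (hG : f l ≤ G) (hG' : f (w - l) ≤ G) : f t * (2 * l) ≤ w * G := by
  have main : ∀ {g : ℝ → ℝ}, IsConcaveProfile w g → g l ≤ G → ∀ {t : ℝ}, t ∈ Ioo 0 w →
      2 * t ≤ w → g t * (2 * l) ≤ w * G := by
    intro g hg hgG t ht htw
    have hG0 : 0 ≤ G := (hg.nonneg l).trans hgG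
    rcases le_total l t with h | h
    · have := hg.mul_le_mul_left_end l0 h ht.2
      nlinarith [hg.nonneg l]
    · have h1 := hg.mul_le_mul_right_end ht.1 h (by linarith)
      have h2 : (w - t) * g l ≤ w * G :=
        mul_le_mul (by linarith [ht.1]) hgG (hg.nonneg _) (by linarith)
      nlinarith [hg.nonneg t]
  by_cases ht : t ∈ Ioo 0 w
  · rcases le_total (2 * t) w with h | h
    · exact main hf hG ht h
    · have := main hf.reflect hG' (t := w - t) ⟨by linarith [ht.2], by linarith [ht.1]⟩
        (by linarith)
      simpa using this
  · rw [hf.eq_zero t ht, zero_mul]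
    exact mul_nonneg (by linarith) ((hf.nonneg l).trans hG)

theorem norm_lineFourier_le_mul (hf : IsConcaveProfile w f) {M : ℝ} (hw : 0 ≤ w)
    (hM : ∀ t, f t ≤ M) (s : ℝ) : ‖lineFourier f s‖ ≤ w * M := by
  refine (norm_lineFourier_le f s).trans ?_
  calc ∫ t, |f t| ≤ ∫ t, (Ioo 0 w).indicator (fun _ => M) t := by
        refine integral_mono hf.integrable.abs ((integrable_indicator_iff measurableSet_Ioo).2
          (integrableOn_const (by simp))) fun t => ?_
        simp only [abs_of_nonneg (hf.nonneg t)]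
        by_cases ht : t ∈ Ioo 0 w
        · rw [indicator_of_mem ht]
          exact hM t
        · rw [indicator_of_notMem ht, hf.eq_zero t ht]
    _ = w * M := by
        rw [integral_indicator measurableSet_Ioo, setIntegral_const,
          Real.volume_real_Ioo_of_le hw, smul_eq_mul, sub_zero]

/-- The step is `h = l / (2δ)`. If `w < 3h`, the supremum of `f` suffices. If `l ≤ h ≤ w/3`, the
growth `f h ≤ (h/l) G` is absorbed by `δ²`. If `h < l ≤ w/10`, both `f h / G` and the end constant
cost at most `10/9`. The worst factor is `100/81 ≤ 5/4`, and `(5/4)² ≤ 2` later gives the stated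
constant. -/
theorem sq_mul_norm_lineFourier_le (hf : IsConcaveProfile w f) {ρ G δ : ℝ} (hρ : 0 < ρ)
    (hρw : 10 ≤ w * ρ) (hG : f ρ⁻¹ ≤ G) (hG' : f (w - ρ⁻¹) ≤ G) (hδ : 0 < δ) (hδ1 : δ ≤ 1) :
    δ ^ 2 * ‖lineFourier f (δ * ρ)‖ ≤ 5 / 4 * (ρ⁻¹ * G) := by
  set l := ρ⁻¹ with hl
  have l0 : 0 < l := inv_pos.2 hρ
  have hlw : 10 * l ≤ w := by
    rw [hl, ← div_eq_mul_inv, div_le_iff₀ hρ]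
    exact hρw
  have hG0 : 0 ≤ G := (hf.nonneg l).trans hG
  have hlG : 0 ≤ l * G := mul_nonneg l0.le hG0
  set h := l / (2 * δ) with hh
  have h0 : 0 < h := by positivity
  have hδh : h * (2 * δ) = l := by rw [hh]; field_simp
  have hs : δ * ρ = 1 / (2 * h) := by
    rw [hh, hl]; field_simp
  rcases lt_or_ge w (3 * h) with hw | hw
  · have hM : ∀ t, f t ≤ w * G / (2 * l) := fun t => by
      rw [le_div_iff₀ (by linarith)]
      exact hf.apply_mul_le l0 (by linarith) hG hG'
    have h1 := hf.norm_lineFourier_le_mul (by linarith) hM (δ * ρ)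
    have h2 : δ * w ≤ 3 / 2 * l := by nlinarith
    have h3 : (δ * w) ^ 2 ≤ (3 / 2 * l) ^ 2 := by
      gcongr
      nlinarith
    calc δ ^ 2 * ‖lineFourier f (δ * ρ)‖ ≤ δ ^ 2 * (w * (w * G / (2 * l))) := by gcongr
      _ = (δ * w) ^ 2 * (G / (2 * l)) := by ring
      _ ≤ (3 / 2 * l) ^ 2 * (G / (2 * l)) := by gcongr
      _ = 9 / 8 * (l * G) := by field_simp; ring
      _ ≤ _ := by linarith
  · rw [hs]
    rcases le_or_gt l h with hle | hlt
    · have main : ∀ {g : ℝ → ℝ}, IsConcaveProfile w g → g l ≤ G → g h ≤ h * G / l := by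
        intro g hg hgG
        rw [le_div_iff₀ l0]
        have := hg.mul_le_mul_left_end l0 hle (by linarith)
        nlinarith
      have h1 := hf.norm_lineFourier_le_of_step h0 hw (c := 3 / 2) (by linarith)
        (main hf hG) (main hf.reflect hG')
      calc δ ^ 2 * ‖lineFourier f (1 / (2 * h))‖ ≤ δ ^ 2 * (2 * h * (3 / 2) * (h * G / l)) := by
            gcongr
        _ = 3 / 4 * (h * (2 * δ)) ^ 2 * (G / l) := by ring
        _ = 3 / 4 * (l * G) := by rw [hδh]; field_simp
        _ ≤ _ := by linarith
    · have main : ∀ {g : ℝ → ℝ}, IsConcaveProfile w g → g l ≤ G → g h ≤ 10 / 9 * G := by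
        intro g hg hgG
        have h2 := hg.mul_le_mul_right_end h0 hlt.le (by linarith)
        have h3 : (w - h) * g l ≤ w * G :=
          mul_le_mul (by linarith) hgG (hg.nonneg _) (by linarith)
        have h4 : (9 / 10 * w) * g h ≤ (w - l) * g h :=
          mul_le_mul_of_nonneg_right (by linarith) (hg.nonneg _)
        have h5 : w * g h ≤ w * (10 / 9 * G) := by linarith
        exact le_of_mul_le_mul_left h5 (by linarith)
      have h1 := hf.norm_lineFourier_le_of_step h0 hw (c := 10 / 9) (by linarith)
        (main hf hG) (main hf.reflect hG')
      calc δ ^ 2 * ‖lineFourier f (1 / (2 * h))‖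
          ≤ δ ^ 2 * (2 * h * (10 / 9) * (10 / 9 * G)) := by gcongr
        _ = 100 / 81 * (δ * ((h * (2 * δ)) * G)) := by ring
        _ ≤ 100 / 81 * (1 * (l * G)) := by rw [hδh]; gcongr
        _ ≤ _ := by linarith

end IsConcaveProfile

/-! ### An oscillatory kernel of constant sign and the lower bound -/

/-- The cosine transform of `s² (1 - s)³` is negative away from the origin. -/
theorem integral_mul_cos_le {x : ℝ} (hx : 12 ≤ x) :
    ∫ s in (0 : ℝ)..1, s ^ 2 * (1 - s) ^ 3 * Real.cos (s * x) ≤ -(6 / x ^ 4) := by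
  have hx0 : x ≠ 0 := by positivity
  -- Repeated integration by parts: the coefficients are the successive derivatives of `s² (1 -
  -- s)³`. Its zeros, double at `0` and triple at `1`, leave boundary terms of order `x⁻⁴`, where
  -- the `-18` from `s = 0` beats the `6 cos x` from `s = 1`.
  have hd : ∀ s : ℝ, HasDerivAt (fun s : ℝ =>
      (s ^ 2 - 3 * s ^ 3 + 3 * s ^ 4 - s ^ 5) * Real.sin (s * x) / x +
      (2 * s - 9 * s ^ 2 + 12 * s ^ 3 - 5 * s ^ 4) * Real.cos (s * x) / x ^ 2 -
      (2 - 18 * s + 36 * s ^ 2 - 20 * s ^ 3) * Real.sin (s * x) / x ^ 3 -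
      (-18 + 72 * s - 60 * s ^ 2) * Real.cos (s * x) / x ^ 4 +
      (72 - 120 * s) * Real.sin (s * x) / x ^ 5 - 120 * Real.cos (s * x) / x ^ 6)
      (s ^ 2 * (1 - s) ^ 3 * Real.cos (s * x)) s := by
    intro s
    have hm : HasDerivAt (fun s : ℝ => s * x) x s := by simpa using (hasDerivAt_id s).mul_const x
    have hS := hm.sin
    have hC := hm.cos
    have p1 := hasDerivAt_id' s
    have p2 := hasDerivAt_pow 2 s
    have p3 := hasDerivAt_pow 3 s
    have p4 := hasDerivAt_pow 4 s
    have p5 := hasDerivAt_pow 5 s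
    have q0 := ((p2.sub (p3.const_mul 3)).add (p4.const_mul 3)).sub p5
    have q1 := (((p1.const_mul 2).sub (p2.const_mul 9)).add (p3.const_mul 12)).sub (p4.const_mul 5)
    have q2 := (((p1.const_mul 18).const_sub 2).add (p2.const_mul 36)).sub (p3.const_mul 20)
    have q3 := ((p1.const_mul 72).const_add (-18)).sub (p2.const_mul 60)
    have q4 := (p1.const_mul 120).const_sub 72
    have h := (((((q0.mul hS).div_const x).add ((q1.mul hC).div_const (x ^ 2))).sub
      ((q2.mul hS).div_const (x ^ 3))).sub ((q3.mul hC).div_const (x ^ 4))).add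
      ((q4.mul hS).div_const (x ^ 5)) |>.sub ((hC.const_mul 120).div_const (x ^ 6))
    refine h.congr_deriv ?_
    simp
    field_simp
    ring
  rw [intervalIntegral.integral_eq_sub_of_hasDerivAt (fun s _ => hd s)
    (Continuous.intervalIntegrable (by fun_prop) _ _)]
  have hs1 := Real.neg_one_le_sin x
  have hc1 := Real.cos_le_one x
  have hc2 := Real.neg_one_le_cos x
  -- For `x ≥ 12` the lower-order terms are at most `48x + 240 ≤ 6x²`.
  have e : (6 * Real.cos x - 18) * x ^ 2 - 48 * Real.sin x * x + 120 * (1 - Real.cos x)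
      ≤ -6 * x ^ 2 := by nlinarith
  have e2 : ((6 * Real.cos x - 18) * x ^ 2 - 48 * Real.sin x * x + 120 * (1 - Real.cos x)) / x ^ 6
      ≤ -6 * x ^ 2 / x ^ 6 := by gcongr
  calc _ = ((6 * Real.cos x - 18) * x ^ 2 - 48 * Real.sin x * x + 120 * (1 - Real.cos x)) /
        x ^ 6 := by
        simp only [one_mul, zero_mul, Real.sin_zero, Real.cos_zero]
        field_simp
        ring
    _ ≤ -6 * x ^ 2 / x ^ 6 := e2
    _ = _ := by field_simp

/-- The variance of `g` on `[0, 1]` is nonnegative. -/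
theorem sq_intervalIntegral_le {g : ℝ → ℝ} (hg : Continuous g) :
    (∫ s in (0 : ℝ)..1, g s) ^ 2 ≤ ∫ s in (0 : ℝ)..1, g s ^ 2 := by
  set k := ∫ s in (0 : ℝ)..1, g s with hk
  have h0 : 0 ≤ ∫ s in (0 : ℝ)..1, (g s - k) ^ 2 :=
    intervalIntegral.integral_nonneg zero_le_one fun s _ => sq_nonneg _
  have h1 : ∫ s in (0 : ℝ)..1, (g s - k) ^ 2 =
      (∫ s in (0 : ℝ)..1, g s ^ 2) - 2 * k * k + k ^ 2 := by
    have e : ∀ s, (g s - k) ^ 2 = g s ^ 2 - 2 * k * g s + k ^ 2 := fun s => by ring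
    simp only [e]
    rw [intervalIntegral.integral_add (Continuous.intervalIntegrable (by fun_prop) _ _)
      (by simp), intervalIntegral.integral_sub (Continuous.intervalIntegrable (by fun_prop) _ _)
      (Continuous.intervalIntegrable (by fun_prop) _ _), intervalIntegral.integral_const_mul, ← hk]
    simp
  nlinarith

theorem abs_integral_mul_cos_le {f : ℝ → ℝ} (hf : Integrable f) (s b : ℝ) :
    |∫ t, f t * Real.cos (2 * Real.pi * s * t + b)| ≤ ‖lineFourier f s‖ := by
  have h : ∫ t, f t * Real.cos (2 * Real.pi * s * t + b) =
      (Complex.exp (-(b : ℂ) * Complex.I) * lineFourier f s).re := by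
    unfold lineFourier
    rw [← integral_const_mul]
    have := integral_re (𝕜 := ℂ)
      ((integrable_mul_exp hf s).const_mul (Complex.exp (-(b : ℂ) * Complex.I)))
    simp only [RCLike.re_eq_complex_re] at this
    rw [← this]
    congr 1
    ext t
    rw [mul_left_comm, ← Complex.exp_add, Complex.re_ofReal_mul]
    congr 1
    have e : -(b : ℂ) * Complex.I + -((2 * Real.pi * s * t : ℝ) : ℂ) * Complex.I =
        ((-(2 * Real.pi * s * t + b) : ℝ) : ℂ) * Complex.I := by
      push_cast; ring
    rw [e, Complex.exp_ofReal_mul_I_re, Real.cos_neg]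
  rw [h]
  refine (Complex.abs_re_le_norm _).trans (le_of_eq ?_)
  rw [norm_mul, norm_exp_neg_ofReal_mul_I, one_mul]

/-- Fubini turns the left side into a weighted integral of real parts of `f̂(sρ)` with phase `s *
b`. That phase shifts the argument of the kernel by `b`, away from the origin. -/
theorem integral_kernel_le {f : ℝ → ℝ} (hf : Integrable f) (ρ b : ℝ) :
    ∫ t, f t * -(∫ s in (0 : ℝ)..1, s ^ 2 * (1 - s) ^ 3 * Real.cos (s * (2 * Real.pi * ρ * t + b)))
      ≤ ∫ s in (0 : ℝ)..1, s ^ 2 * ‖lineFourier f (s * ρ)‖ := by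
  have hpoly : ∀ s ∈ Icc (0 : ℝ) 1, 0 ≤ s ^ 2 * (1 - s) ^ 3 ∧ s ^ 2 * (1 - s) ^ 3 ≤ s ^ 2 := by
    intro s hs
    have h1 : 0 ≤ 1 - s := by linarith [hs.2]
    have h2 : (1 - s) ^ 3 ≤ 1 := pow_le_one₀ h1 (by linarith [hs.1])
    exact ⟨by positivity, by nlinarith [sq_nonneg s]⟩
  have hint : Integrable (Function.uncurry fun (t s : ℝ) =>
      f t * (s ^ 2 * (1 - s) ^ 3 * Real.cos (s * (2 * Real.pi * ρ * t + b))))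
      (volume.prod (volume.restrict (Ioc (0 : ℝ) 1))) := by
    have h1 : Integrable (fun p : ℝ × ℝ => f p.1 * 1)
        (volume.prod (volume.restrict (Ioc (0 : ℝ) 1))) :=
      hf.mul_prod (integrable_const (1 : ℝ))
    have h2 := h1.mul_bdd (c := 1)
      -- The weight is clamped to be bounded on the whole plane; for `s` in `(0, 1]` clamping
      -- changes nothing.
      (g := fun p : ℝ × ℝ => (max (-1) (min 1 (p.2 ^ 2 * (1 - p.2) ^ 3))) *
        Real.cos (p.2 * (2 * Real.pi * ρ * p.1 + b)))
      (Continuous.aestronglyMeasurable (by fun_prop)) (Filter.Eventually.of_forall fun p => by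
        rw [norm_mul]
        refine mul_le_one₀ ?_ (norm_nonneg _) (Real.abs_cos_le_one _)
        rw [Real.norm_eq_abs, abs_le]
        exact ⟨le_max_left _ _, max_le (by norm_num) (min_le_left _ _)⟩)
    refine h2.congr ?_
    have h3 : ∀ᵐ p ∂((volume : Measure ℝ).prod (volume.restrict (Ioc (0 : ℝ) 1))),
        p.2 ∈ Ioc (0 : ℝ) 1 :=
      Measure.quasiMeasurePreserving_snd.ae (ae_restrict_mem measurableSet_Ioc)
    filter_upwards [h3] with p hp
    have h4 := hpoly p.2 ⟨hp.1.le, hp.2⟩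
    have h5 : p.2 ^ 2 ≤ 1 := pow_le_one₀ hp.1.le hp.2
    simp only [Function.uncurry]
    rw [min_eq_right (by linarith), max_eq_right (by linarith), mul_one]
  have hswap : ∫ t, f t * -(∫ s in (0 : ℝ)..1,
      s ^ 2 * (1 - s) ^ 3 * Real.cos (s * (2 * Real.pi * ρ * t + b))) =
      ∫ s in (0 : ℝ)..1, -(s ^ 2 * (1 - s) ^ 3 *
        ∫ t, f t * Real.cos (2 * Real.pi * (s * ρ) * t + s * b)) := by
    have := integral_integral_swap hint
    rw [intervalIntegral.integral_neg]
    simp only [mul_neg, integral_neg, intervalIntegral.integral_of_le zero_le_one,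
      ← integral_const_mul]
    rw [this]
    congr 2
    ext s
    congr 1
    ext t
    ring_nf
  rw [hswap]
  have hc := continuous_lineFourier hf
  have hcont : Continuous fun s : ℝ => ∫ t, f t * Real.cos (2 * Real.pi * (s * ρ) * t + s * b) := by
    refine continuous_of_dominated (bound := fun t => ‖f t‖) ?_ ?_ hf.norm ?_
    · intro s
      exact hf.aestronglyMeasurable.mul (Continuous.aestronglyMeasurable (by fun_prop))
    · intro s
      refine Filter.Eventually.of_forall fun t => ?_
      rw [norm_mul]
      exact mul_le_of_le_one_right (norm_nonneg _) (Real.abs_cos_le_one _)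
    · exact Filter.Eventually.of_forall fun t => by fun_prop
  refine intervalIntegral.integral_mono_on zero_le_one
    (Continuous.intervalIntegrable (by fun_prop) _ _)
    (Continuous.intervalIntegrable (by fun_prop) _ _) fun s hs => ?_
  have h1 := abs_integral_mul_cos_le hf (s * ρ) (s * b)
  obtain ⟨h2, h3⟩ := hpoly s hs
  set I := ∫ t, f t * Real.cos (2 * Real.pi * (s * ρ) * t + s * b)
  calc -(s ^ 2 * (1 - s) ^ 3 * I) = s ^ 2 * (1 - s) ^ 3 * -I := by ring
    _ ≤ s ^ 2 * (1 - s) ^ 3 * |I| := mul_le_mul_of_nonneg_left (neg_le_abs I) h2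
    _ ≤ s ^ 2 * ‖lineFourier f (s * ρ)‖ := mul_le_mul h3 h1 (abs_nonneg _) (sq_nonneg _)

namespace IsConcaveProfile

variable {w : ℝ} {f : ℝ → ℝ}

theorem mul_apply_le_integral (hf : IsConcaveProfile w f) {ρ : ℝ} (hρ : 0 < ρ)
    (hρw : 10 ≤ w * ρ) : 3 / 390625 * (ρ⁻¹ * f ρ⁻¹) ≤
      ∫ s in (0 : ℝ)..1, s ^ 2 * ‖lineFourier f (s * ρ)‖ := by
  -- The shift 12 puts every `t ≥ 0` in the range where the kernel is positive.
  refine le_trans ?_ (integral_kernel_le hf.integrable ρ 12)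
  set l := ρ⁻¹ with hl
  have l0 : 0 < l := inv_pos.2 hρ
  have hlw : 10 * l ≤ w := by
    rw [hl, ← div_eq_mul_inv, div_le_iff₀ hρ]
    exact hρw
  have hρl : ρ * l = 1 := mul_inv_cancel₀ hρ.ne'
  set J : ℝ → ℝ := fun t => -(∫ s in (0 : ℝ)..1, s ^ 2 * (1 - s) ^ 3 *
    Real.cos (s * (2 * Real.pi * ρ * t + 12))) with hJ
  have hJbound : ∀ t, 0 ≤ t → 6 / (2 * Real.pi * ρ * t + 12) ^ 4 ≤ J t := by
    intro t ht
    have h1 : 0 ≤ 2 * Real.pi * ρ * t := by positivity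
    have := integral_mul_cos_le (x := 2 * Real.pi * ρ * t + 12) (by linarith)
    simp only [hJ]
    linarith
  have hJnorm : ∀ t, ‖J t‖ ≤ 1 := by
    intro t
    simp only [hJ, norm_neg]
    refine (intervalIntegral.norm_integral_le_of_norm_le_const (C := 1) fun s hs => ?_).trans
      (by norm_num)
    rw [uIoc_of_le zero_le_one] at hs
    have h1 : 0 ≤ 1 - s := by linarith [hs.2]
    rw [norm_mul, norm_mul, norm_pow, norm_pow, Real.norm_of_nonneg hs.1.le, Real.norm_of_nonneg h1]
    have h2 : s ^ 2 ≤ 1 := pow_le_one₀ hs.1.le hs.2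
    have h3 : (1 - s) ^ 3 ≤ 1 := pow_le_one₀ h1 (by linarith [hs.1])
    exact mul_le_one₀ (mul_le_one₀ h2 (by positivity) h3) (norm_nonneg _) (Real.abs_cos_le_one _)
  have hJcont : Continuous J := by
    refine Continuous.neg (intervalIntegral.continuous_parametric_intervalIntegral_of_continuous'
      (f := fun t s => s ^ 2 * (1 - s) ^ 3 * Real.cos (s * (2 * Real.pi * ρ * t + 12))) ?_ 0 1)
    unfold Function.uncurry
    fun_prop
  have hi : Integrable fun t => f t * J t :=
    hf.integrable.mul_bdd hJcont.aestronglyMeasurable (Filter.Eventually.of_forall hJnorm)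
  have hlow : ∀ t, (Icc l (2 * l)).indicator (fun _ => f l / 2 * (6 / 390625)) t ≤ f t * J t := by
    intro t
    by_cases ht : t ∈ Icc l (2 * l)
    · rw [indicator_of_mem ht]
      have h1 := hf.mul_le_mul_right_end l0 ht.1 (by linarith [ht.2])
      have h2 : f l / 2 ≤ f t := by
        have h3 : (w - l) / 2 * f l ≤ (w - t) * f l :=
          mul_le_mul_of_nonneg_right (by linarith [ht.2]) (hf.nonneg _)
        have h4 : (w - l) * (f l / 2) ≤ (w - l) * f t := by linarith
        exact le_of_mul_le_mul_left h4 (by linarith)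
      have ht0 : 0 ≤ t := l0.le.trans ht.1
      -- Here `4π + 12 < 25`, and `25⁴ = 390625`.
      have h5 : 2 * Real.pi * ρ * t + 12 ≤ 25 := by
        have h6 : ρ * t ≤ 2 := by nlinarith [ht.2]
        have h7 := Real.pi_lt_d2
        have h8 : 0 ≤ ρ * t := by positivity
        nlinarith [Real.pi_pos]
      have h9 : (0 : ℝ) < 2 * Real.pi * ρ * t + 12 := by positivity
      have h10 : (6 : ℝ) / 390625 ≤ J t := by
        refine le_trans ?_ (hJbound t ht0)
        have : (2 * Real.pi * ρ * t + 12) ^ 4 ≤ 25 ^ 4 := by gcongr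
        norm_num at this
        gcongr
      exact mul_le_mul h2 h10 (by norm_num) (hf.nonneg _)
    · rw [indicator_of_notMem ht]
      by_cases ht' : t ∈ Ioo 0 w
      · refine mul_nonneg (hf.nonneg _) (le_trans ?_ (hJbound t ht'.1.le))
        positivity
      · rw [hf.eq_zero t ht', zero_mul]
  calc 3 / 390625 * (l * f l) =
        ∫ t, (Icc l (2 * l)).indicator (fun _ => f l / 2 * (6 / 390625)) t := by
        rw [integral_indicator measurableSet_Icc, setIntegral_const,
          Real.volume_real_Icc_of_le (by linarith), smul_eq_mul]
        ring
    _ ≤ ∫ t, f t * J t := integral_mono ((integrable_indicator_iff measurableSet_Icc).2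
        (integrableOn_const (by simp))) hi hlow

theorem integral_bounds (hf : IsConcaveProfile w f) {ρ : ℝ} (hρ : 0 < ρ) (hρw : 10 ≤ w * ρ) :
    (3 / 390625) ^ 2 * (ρ ^ 2)⁻¹ * max (f ρ⁻¹) (f (w - ρ⁻¹)) ^ 2 ≤
        ∫ s in (0 : ℝ)..1, (s ^ 2 * ‖lineFourier f (s * ρ)‖) ^ 2 ∧
      ∫ s in (0 : ℝ)..1, (s ^ 2 * ‖lineFourier f (s * ρ)‖) ^ 2 ≤
        2 * (ρ ^ 2)⁻¹ * max (f ρ⁻¹) (f (w - ρ⁻¹)) ^ 2 := by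
  have hc := continuous_lineFourier hf.integrable
  have hcont : Continuous fun s : ℝ => s ^ 2 * ‖lineFourier f (s * ρ)‖ := by fun_prop
  have hρi : 0 < ρ⁻¹ := inv_pos.2 hρ
  constructor
  · refine le_trans ?_ (sq_intervalIntegral_le hcont)
    have h1 := hf.mul_apply_le_integral hρ hρw
    have h2 := hf.reflect.mul_apply_le_integral hρ hρw
    simp only [norm_lineFourier_comp_sub_left] at h2
    have h3 : 3 / 390625 * (ρ⁻¹ * max (f ρ⁻¹) (f (w - ρ⁻¹))) ≤
        ∫ s in (0 : ℝ)..1, s ^ 2 * ‖lineFourier f (s * ρ)‖ := by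
      rcases max_choice (f ρ⁻¹) (f (w - ρ⁻¹)) with h | h <;> rw [h] <;> assumption
    have h4 : 0 ≤ max (f ρ⁻¹) (f (w - ρ⁻¹)) := le_max_of_le_left (hf.nonneg _)
    calc _ = (3 / 390625 * (ρ⁻¹ * max (f ρ⁻¹) (f (w - ρ⁻¹)))) ^ 2 := by
          rw [← inv_pow]; ring
      _ ≤ _ := by gcongr
  · set G := max (f ρ⁻¹) (f (w - ρ⁻¹))
    have h1 : ∀ s ∈ Ioo (0 : ℝ) 1, (s ^ 2 * ‖lineFourier f (s * ρ)‖) ^ 2 ≤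
        2 * (ρ ^ 2)⁻¹ * G ^ 2 := by
      intro s hs
      have h2 := hf.sq_mul_norm_lineFourier_le hρ hρw (le_max_left _ _) (le_max_right _ _) hs.1
        hs.2.le
      calc _ ≤ (5 / 4 * (ρ⁻¹ * G)) ^ 2 := by gcongr
        _ = 25 / 16 * (ρ⁻¹ * G) ^ 2 := by ring
        _ ≤ 2 * (ρ⁻¹ * G) ^ 2 := by gcongr; norm_num
        _ = _ := by rw [← inv_pow]; ring
    have h2 := intervalIntegral.integral_mono_on_of_le_Ioo zero_le_one
      ((hcont.pow 2).intervalIntegrable 0 1) (intervalIntegrable_const (μ := volume)) h1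
    refine h2.trans (le_of_eq ?_)
    simp

end IsConcaveProfile

/-! ### Orthonormal frames, slices and chords -/

/-- The angle `θ + π / 2`. -/
def perp (θ : Real.Angle) : Real.Angle := θ + ((Real.pi / 2 : ℝ) : Real.Angle)

theorem inner_u_u (θ : Real.Angle) : ⟪u θ, u θ⟫ = 1 := by
  simp only [u, PiLp.inner_apply, Fin.sum_univ_two]
  simpa [sq] using Real.Angle.cos_sq_add_sin_sq θ

theorem inner_u_perp (θ : Real.Angle) : ⟪u θ, u (perp θ)⟫ = 0 := by
  simp [u, perp, PiLp.inner_apply, Fin.sum_univ_two, Real.Angle.cos_add, Real.Angle.sin_add]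
  ring

theorem norm_u (θ : Real.Angle) : ‖u θ‖ = 1 := by
  rw [norm_eq_sqrt_real_inner, inner_u_u, Real.sqrt_one]

theorem u_add_pi (θ : Real.Angle) : u (θ + (Real.pi : Real.Angle)) = -u θ := by
  ext i
  fin_cases i <;> simp [u]

theorem orthonormal_frame (θ : Real.Angle) : Orthonormal ℝ ![u θ, u (perp θ)] := by
  refine ⟨fun i => ?_, fun i j hij => ?_⟩
  · fin_cases i <;> simp [norm_u]
  · fin_cases i <;> fin_cases j <;> simp at hij ⊢
    · exact inner_u_perp θ
    · rw [real_inner_comm]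
      exact inner_u_perp θ

/-- The orthonormal basis `u θ, u (θ + π / 2)`. -/
def frame (θ : Real.Angle) : OrthonormalBasis (Fin 2) ℝ Plane :=
  OrthonormalBasis.mk (orthonormal_frame θ) (by
    rw [(orthonormal_frame θ).linearIndependent.span_eq_top_of_card_eq_finrank' (by simp)])

/-- The coordinates of a point with respect to the basis `u θ, u (θ + π / 2)`. -/
def coords (θ : Real.Angle) : Plane ≃ᵐ ℝ × ℝ :=
  ((frame θ).measurableEquiv.trans (MeasurableEquiv.toLp 2 (Fin 2 → ℝ)).symm).trans
    MeasurableEquiv.finTwoArrow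

theorem coords_apply (θ : Real.Angle) (x : Plane) :
    coords θ x = (⟪x, u θ⟫, ⟪x, u (perp θ)⟫) := by
  have h : coords θ x = ((frame θ).repr x 0, (frame θ).repr x 1) := rfl
  rw [h, OrthonormalBasis.repr_apply_apply, OrthonormalBasis.repr_apply_apply]
  simp [frame, real_inner_comm]

theorem coords_symm_apply (θ : Real.Angle) (p : ℝ × ℝ) :
    (coords θ).symm p = p.1 • u θ + p.2 • u (perp θ) := by
  rw [MeasurableEquiv.symm_apply_eq, coords_apply]
  have h := inner_u_perp θ
  have h' := real_inner_comm (u θ) (u (perp θ))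
  simp [inner_add_left, inner_smul_left, norm_u, h, h']

theorem measurePreserving_coords (θ : Real.Angle) : MeasurePreserving (coords θ) :=
  (((frame θ).measurePreserving_measurableEquiv).trans
    (EuclideanSpace.volume_preserving_symm_measurableEquiv_toLp (Fin 2))).trans
      (volume_preserving_finTwoArrow ℝ)

theorem norm_sq_eq (θ : Real.Angle) (x : Plane) :
    ‖x‖ ^ 2 = ⟪x, u θ⟫ ^ 2 + ⟪x, u (perp θ)⟫ ^ 2 := by
  have h := (frame θ).sum_sq_norm_inner_right x
  simp [frame, Fin.sum_univ_two] at h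
  rw [← h, real_inner_comm, real_inner_comm (u (perp θ))]

/-- The slice of `C` on the line `x · u θ = t`, in the coordinate along `u (θ + π / 2)`. -/
def slice (C : Set Plane) (θ : Real.Angle) (t : ℝ) : Set ℝ :=
  {r | t • u θ + r • u (perp θ) ∈ C}

theorem isometry_line (θ : Real.Angle) (t : ℝ) :
    Isometry fun r : ℝ => t • u θ + r • u (perp θ) := by
  refine Isometry.of_dist_eq fun x y => ?_
  rw [dist_add_left, dist_eq_norm, ← sub_smul, norm_smul, norm_u, mul_one, dist_eq_norm]

theorem inner_line (θ : Real.Angle) (t r : ℝ) : ⟪t • u θ + r • u (perp θ), u θ⟫ = t := by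
  have h' := real_inner_comm (u θ) (u (perp θ))
  simp [inner_add_left, inner_smul_left, norm_u, inner_u_perp, h']

theorem setOf_inner_eq_image_slice (C : Set Plane) (θ : Real.Angle) (t : ℝ) :
    {x | x ∈ C ∧ ⟪x, u θ⟫ = t} = (fun r : ℝ => t • u θ + r • u (perp θ)) '' slice C θ t := by
  ext x
  constructor
  · rintro ⟨hx, rfl⟩
    have h := (coords θ).symm_apply_apply x
    rw [coords_symm_apply, coords_apply] at h
    exact ⟨⟪x, u (perp θ)⟫, by simpa [slice, h] using hx, h⟩
  · rintro ⟨r, hr, rfl⟩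
    exact ⟨hr, inner_line θ t r⟩

/-- The least value of `x · u θ` on `C`. -/
def lo (C : Set Plane) (θ : Real.Angle) : ℝ := ⨅ y : C, ⟪(y : Plane), u θ⟫

/-- The largest value of `x · u θ` on `C`. -/
def hi (C : Set Plane) (θ : Real.Angle) : ℝ := ⨆ y : C, ⟪(y : Plane), u θ⟫

theorem chordLength_eq (C : Set Plane) (θ : Real.Angle) (l : ℝ) :
    chordLength C θ l = Metric.diam (slice C θ (lo C θ + l)) := by
  rw [← (isometry_line θ (lo C θ + l)).diam_image, ← setOf_inner_eq_image_slice]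
  rfl

theorem lo_add_pi (C : Set Plane) (θ : Real.Angle) :
    lo C (θ + (Real.pi : Real.Angle)) = -hi C θ := by
  simp only [lo, hi, u_add_pi, inner_neg_right]
  rw [iInf, iSup, ← Real.sInf_neg]
  congr 1
  ext x
  simp [neg_eq_iff_eq_neg]

theorem chordLength_add_pi (C : Set Plane) (θ : Real.Angle) (l : ℝ) :
    chordLength C (θ + (Real.pi : Real.Angle)) l = chordLength C θ (hi C θ - lo C θ - l) := by
  have h := lo_add_pi C θ
  unfold chordLength chord
  congr 1
  ext x
  change _ ∧ _ = lo _ _ + _ ↔ _ ∧ _ = lo _ _ + _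
  rw [h, u_add_pi, inner_neg_right]
  refine and_congr_right fun _ => ⟨fun h => by linarith, fun h => by linarith⟩

/-- A bounded convex set of reals lies between the open and the closed interval with its infimum and
supremum as ends. -/
theorem volume_real_eq_diam {s : Set ℝ} (hs : Convex ℝ s) (hb : Bornology.IsBounded s) :
    volume.real s = Metric.diam s := by
  rcases s.eq_empty_or_nonempty with rfl | hne
  · simp
  have hba := hb.bddAbove
  have hbb := hb.bddBelow
  have hle : sInf s ≤ sSup s := Real.sInf_le_sSup s hbb hba
  rw [Real.diam_eq hb]
  have h1 : Ioo (sInf s) (sSup s) ⊆ s := by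
    rintro x ⟨hx1, hx2⟩
    obtain ⟨a, ha, hax⟩ := exists_lt_of_csInf_lt hne hx1
    obtain ⟨b, hb', hxb⟩ := exists_lt_of_lt_csSup hne hx2
    exact hs.ordConnected.out ha hb' ⟨hax.le, hxb.le⟩
  have h2 : s ⊆ Icc (sInf s) (sSup s) := fun x hx => ⟨csInf_le hbb hx, le_csSup hba hx⟩
  refine le_antisymm ?_ ?_
  · rw [← Real.volume_real_Icc_of_le hle]
    exact measureReal_mono h2 (by simp)
  · rw [← Real.volume_real_Ioo_of_le hle]
    exact measureReal_mono h1 hb.measure_lt_top.ne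

theorem convex_slice {C : Set Plane} (hC : Convex ℝ C) (θ : Real.Angle) (t : ℝ) :
    Convex ℝ (slice C θ t) := by
  intro x hx y hy a b ha hb hab
  have h := hC hx hy ha hb hab
  have e : a • (t • u θ + x • u (perp θ)) + b • (t • u θ + y • u (perp θ)) =
      t • u θ + (a • x + b • y) • u (perp θ) := by
    have : t = a * t + b * t := by rw [← add_mul, hab, one_mul]
    nth_rewrite 3 [this]
    simp only [smul_eq_mul]
    module
  rwa [e] at h

theorem isBounded_slice {C : Set Plane} (hC : Bornology.IsBounded C) (θ : Real.Angle) (t : ℝ) :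
    Bornology.IsBounded (slice C θ t) := by
  have h := (isometry_line θ t).antilipschitz.isBounded_preimage hC
  exact h

/-- One-dimensional Brunn–Minkowski: the slice at a convex combination contains the Minkowski
combination of the slices, on which suprema and infima are additive. Empty slices must be excluded.
-/
theorem diam_slice_concave {C : Set Plane} (hC : Convex ℝ C) (hb : Bornology.IsBounded C)
    (θ : Real.Angle) {t t' a b : ℝ} (ht : (slice C θ t).Nonempty) (ht' : (slice C θ t').Nonempty)
    (h0a : 0 ≤ a) (h0b : 0 ≤ b) (hab : a + b = 1) :
    a * Metric.diam (slice C θ t) + b * Metric.diam (slice C θ t') ≤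
      Metric.diam (slice C θ (a * t + b * t')) := by
  have hsub : a • slice C θ t + b • slice C θ t' ⊆ slice C θ (a * t + b * t') := by
    rintro _ ⟨_, ⟨x, hx, rfl⟩, _, ⟨y, hy, rfl⟩, rfl⟩
    have h := hC hx hy h0a h0b hab
    have e : a • (t • u θ + x • u (perp θ)) + b • (t' • u θ + y • u (perp θ)) =
        (a * t + b * t') • u θ + (a • x + b • y) • u (perp θ) := by
      simp only [smul_eq_mul]
      module
    rwa [e] at h
  have B := isBounded_slice hb θ
  have ba : BddAbove (a • slice C θ t) := (B t).bddAbove.smul_of_nonneg h0a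
  have bb : BddAbove (b • slice C θ t') := (B t').bddAbove.smul_of_nonneg h0b
  have ba' : BddBelow (a • slice C θ t) := (B t).bddBelow.smul_of_nonneg h0a
  have bb' : BddBelow (b • slice C θ t') := (B t').bddBelow.smul_of_nonneg h0b
  have h1 := csSup_le_csSup (B _).bddAbove (ht.smul_set.add ht'.smul_set) hsub
  have h2 := csInf_le_csInf (B _).bddBelow (ht.smul_set.add ht'.smul_set) hsub
  rw [csSup_add ht.smul_set ba ht'.smul_set bb, Real.sSup_smul_of_nonneg h0a,
    Real.sSup_smul_of_nonneg h0b] at h1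
  rw [csInf_add ht.smul_set ba' ht'.smul_set bb', Real.sInf_smul_of_nonneg h0a,
    Real.sInf_smul_of_nonneg h0b] at h2
  rw [Real.diam_eq (B _), Real.diam_eq (B _), Real.diam_eq (B _)]
  simp only [smul_eq_mul] at h1 h2
  linarith

theorem bddAbove_inner {C : Set Plane} (hb : Bornology.IsBounded C) (θ : Real.Angle) :
    BddAbove (range fun y : C => ⟪(y : Plane), u θ⟫) := by
  obtain ⟨R, hR⟩ := hb.exists_norm_le
  refine ⟨R, ?_⟩
  rintro _ ⟨y, rfl⟩
  refine (real_inner_le_norm _ _).trans ?_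
  rw [norm_u, mul_one]
  exact hR y y.2

theorem bddBelow_inner {C : Set Plane} (hb : Bornology.IsBounded C) (θ : Real.Angle) :
    BddBelow (range fun y : C => ⟪(y : Plane), u θ⟫) := by
  obtain ⟨R, hR⟩ := hb.exists_norm_le
  refine ⟨-R, ?_⟩
  rintro _ ⟨y, rfl⟩
  have h := (abs_le.1 (abs_real_inner_le_norm (y : Plane) (u θ))).1
  rw [norm_u, mul_one] at h
  linarith [hR y y.2]

theorem lo_le {C : Set Plane} (hb : Bornology.IsBounded C) (θ : Real.Angle) {x : Plane}
    (hx : x ∈ C) : lo C θ ≤ ⟪x, u θ⟫ :=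
  ciInf_le (bddBelow_inner hb θ) ⟨x, hx⟩

theorem le_hi {C : Set Plane} (hb : Bornology.IsBounded C) (θ : Real.Angle) {x : Plane}
    (hx : x ∈ C) : ⟪x, u θ⟫ ≤ hi C θ :=
  le_ciSup (bddAbove_inner hb θ) ⟨x, hx⟩

theorem slice_eq_empty {C : Set Plane} (hb : Bornology.IsBounded C) (θ : Real.Angle) {t : ℝ}
    (ht : t ∉ Icc (lo C θ) (hi C θ)) : slice C θ t = ∅ := by
  refine eq_empty_of_forall_notMem fun r hr => ht ?_
  rw [← inner_line θ t r]
  exact ⟨lo_le hb θ hr, le_hi hb θ hr⟩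

theorem slice_nonempty {C : Set Plane} (hC : Convex ℝ C) (hne : C.Nonempty) (θ : Real.Angle)
    {t : ℝ} (ht : t ∈ Ioo (lo C θ) (hi C θ)) : (slice C θ t).Nonempty := by
  have : Nonempty C := hne.to_subtype
  obtain ⟨⟨x, hx⟩, hxt⟩ := exists_lt_of_ciInf_lt ht.1
  obtain ⟨⟨y, hy⟩, hyt⟩ := exists_lt_of_lt_ciSup ht.2
  have hconv : Convex ℝ ((fun z : Plane => ⟪z, u θ⟫) '' C) :=
    hC.is_linear_image ⟨fun a b => inner_add_left _ _ _, fun a b => by simp [inner_smul_left]⟩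
  obtain ⟨z, hz, hzt⟩ := hconv.ordConnected.out (mem_image_of_mem _ hx) (mem_image_of_mem _ hy)
    ⟨hxt.le, hyt.le⟩
  have h : z ∈ {x | x ∈ C ∧ ⟪x, u θ⟫ = t} := ⟨hz, hzt⟩
  rw [setOf_inner_eq_image_slice] at h
  exact (image_nonempty.1 ⟨z, h⟩)

/-! ### The chord-length profile and the Fourier transform of the body -/

/-- The length of the chord at distance `l` from the supporting line, for interior chords. -/
def profile (C : Set Plane) (θ : Real.Angle) : ℝ → ℝ :=
  (Ioo 0 (hi C θ - lo C θ)).indicator (chordLength C θ)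

theorem profile_of_mem {C : Set Plane} {θ : Real.Angle} {l : ℝ} (h0 : 0 < l)
    (h1 : l < hi C θ - lo C θ) : profile C θ l = chordLength C θ l :=
  indicator_of_mem (s := Ioo 0 (hi C θ - lo C θ)) ⟨h0, h1⟩ _

/-- The two supporting lines must be left out: they may meet `C` in a segment of positive length,
while the profile vanishes there. -/
theorem profile_sub_ae_eq {C : Set Plane} (hC : Convex ℝ C) (hb : Bornology.IsBounded C)
    (θ : Real.Angle) :
    (fun t => volume.real (slice C θ t)) =ᵐ[volume] fun t => profile C θ (t + -lo C θ) := by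
  have h1 : ∀ᵐ t : ℝ, t ≠ lo C θ := Measure.ae_ne volume _
  have h2 : ∀ᵐ t : ℝ, t ≠ hi C θ := Measure.ae_ne volume _
  filter_upwards [h1, h2] with t ht1 ht2
  by_cases ht : t ∈ Icc (lo C θ) (hi C θ)
  · have h3 := lt_of_le_of_ne ht.1 ht1.symm
    have h4 := lt_of_le_of_ne ht.2 ht2
    rw [profile_of_mem (by linarith) (by linarith), chordLength_eq,
      volume_real_eq_diam (convex_slice hC θ t) (isBounded_slice hb θ t)]
    congr 2
    ring
  · rw [slice_eq_empty hb θ ht, profile, indicator_of_notMem]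
    · simp
    · exact fun h => ht ⟨by linarith [h.1], by linarith [h.2]⟩

theorem integrable_indicator_coords {C : Set Plane} (hC : Convex ℝ C)
    (hb : Bornology.IsBounded C) (θ : Real.Angle) :
    Integrable (fun p : ℝ × ℝ => C.indicator (fun _ => (1 : ℝ)) ((coords θ).symm p))
      (volume.prod volume) := by
  have h : Integrable (C.indicator fun _ => (1 : ℝ)) volume :=
    (integrableOn_const hb.measure_lt_top.ne).integrable_indicator₀ (hC.nullMeasurableSet volume)
  exact ((measurePreserving_coords θ).symm.integrable_comp_emb
    (coords θ).symm.measurableEmbedding).2 h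

theorem integral_indicator_slice {C : Set Plane} (hC : Convex ℝ C) (θ : Real.Angle) (t : ℝ) :
    ∫ r, C.indicator (fun _ => (1 : ℝ)) ((coords θ).symm (t, r)) = volume.real (slice C θ t) := by
  have h : (fun r => C.indicator (fun _ => (1 : ℝ)) ((coords θ).symm (t, r))) =
      (slice C θ t).indicator fun _ => (1 : ℝ) := by
    ext r
    rw [coords_symm_apply]
    rfl
  rw [h, integral_indicator₀ ((convex_slice hC θ t).nullMeasurableSet volume)]
  simp

theorem isConcaveProfile_profile {C : Set Plane} (hC : IsConvexBody C) (θ : Real.Angle) :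
    IsConcaveProfile (hi C θ - lo C θ) (profile C θ) where
  concave := by
    refine ⟨convex_Ioo _ _, fun x hx y hy a b ha hb hab => ?_⟩
    have hxy := convex_Ioo 0 (hi C θ - lo C θ) hx hy ha hb hab
    have hne : C.Nonempty := hC.interior_nonempty.mono interior_subset
    rw [profile_of_mem hx.1 hx.2, profile_of_mem hy.1 hy.2, profile_of_mem hxy.1 hxy.2]
    simp only [chordLength_eq, smul_eq_mul]
    refine (diam_slice_concave hC.convex hC.isBounded θ
      (slice_nonempty hC.convex hne θ ⟨by linarith [hx.1], by linarith [hx.2]⟩)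
      (slice_nonempty hC.convex hne θ ⟨by linarith [hy.1], by linarith [hy.2]⟩)
      ha hb hab).trans (le_of_eq ?_)
    congr 2
    linear_combination lo C θ * hab
  nonneg t := indicator_nonneg (fun _ _ => Metric.diam_nonneg) t
  eq_zero t ht := indicator_of_notMem ht _
  integrable := by
    have h := (integrable_indicator_coords hC.convex hC.isBounded θ).integral_prod_left
    simp only [integral_indicator_slice hC.convex] at h
    have h2 := (h.congr (profile_sub_ae_eq hC.convex hC.isBounded θ)).comp_add_right (lo C θ)
    simpa using h2

/-- Fubini in the rotated coordinates; moving the origin to the supporting line costs only a phase.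
-/
theorem norm_indicatorFourier_smul_u {C : Set Plane} (hC : IsConvexBody C) (θ : Real.Angle)
    (s : ℝ) : ‖indicatorFourier C (s • u θ)‖ = ‖lineFourier (profile C θ) s‖ := by
  have hi := (integrable_indicator_coords hC.convex hC.isBounded θ).ofReal (𝕜 := ℂ)
  have hint : Integrable (fun p : ℝ × ℝ =>
      ((C.indicator (fun _ => (1 : ℝ)) ((coords θ).symm p) : ℝ) : ℂ) *
        Complex.exp (-(2 * Real.pi * s * p.1 : ℝ) * Complex.I)) (volume.prod volume) := by
    refine hi.mul_bdd (c := 1) (Continuous.aestronglyMeasurable (by fun_prop)) ?_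
    exact Filter.Eventually.of_forall fun p => (norm_exp_neg_ofReal_mul_I _).le
  have h1 : indicatorFourier C (s • u θ) = ∫ p : ℝ × ℝ,
      ((C.indicator (fun _ => (1 : ℝ)) ((coords θ).symm p) : ℝ) : ℂ) *
        Complex.exp (-(2 * Real.pi * s * p.1 : ℝ) * Complex.I) := by
    rw [indicatorFourier, Real.fourier_eq', ← (measurePreserving_coords θ).symm.integral_comp'
      (f := (coords θ).symm)]
    congr 1
    ext p
    have e : ⟪(coords θ).symm p, s • u θ⟫ = s * p.1 := by
      rw [coords_symm_apply, inner_smul_right, inner_line]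
    rw [e, smul_eq_mul, mul_comm]
    congr 1
    · by_cases hp : (coords θ).symm p ∈ C <;> simp [hp]
    · congr 1
      push_cast
      ring
  have h2 : indicatorFourier C (s • u θ) =
      lineFourier (fun t => profile C θ (t + -lo C θ)) s := by
    rw [h1, Measure.volume_eq_prod, integral_prod _ hint, lineFourier]
    refine integral_congr_ae ?_
    filter_upwards [profile_sub_ae_eq hC.convex hC.isBounded θ] with t ht
    rw [← ht, integral_mul_const, integral_complex_ofReal, integral_indicator_slice hC.convex]
  rw [h2, lineFourier_comp_add, norm_mul, Complex.norm_exp_ofReal_mul_I, one_mul]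

theorem indicatorFourier_smul (C : Set Plane) {δ : ℝ} (hδ : 0 < δ) (ξ : Plane) :
    indicatorFourier (δ • C) ξ = (δ : ℂ) ^ 2 * indicatorFourier C (δ • ξ) := by
  simp only [indicatorFourier, Real.fourier_eq']
  have h := Measure.integral_comp_smul (volume : Measure Plane)
    (fun v => Complex.exp ((-2 * Real.pi * ⟪v, ξ⟫ : ℝ) * Complex.I) •
      (δ • C).indicator (fun _ => (1 : ℂ)) v) δ
  have e : ∀ v : Plane, (δ • C).indicator (fun _ => (1 : ℂ)) (δ • v) =
      C.indicator (fun _ => (1 : ℂ)) v := fun v => by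
    by_cases hv : v ∈ C
    · rw [indicator_of_mem hv, indicator_of_mem (smul_mem_smul_set hv)]
    · rw [indicator_of_notMem hv,
        indicator_of_notMem fun h => hv ((smul_mem_smul_set_iff₀ hδ.ne' _ _).1 h)]
  simp only [e, inner_smul_left, finrank_euclideanSpace, Fintype.card_fin] at h
  simp only [inner_smul_right]
  simp only [conj_trivial] at h
  rw [h, abs_of_pos (by positivity), Complex.real_smul, ← mul_assoc]
  push_cast
  rw [mul_inv_cancel₀ (pow_ne_zero 2 (Complex.ofReal_ne_zero.2 hδ.ne')), one_mul]

/-! ### Comparison of diameters and width -/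

theorem chordLength_le_longDiam {C : Set Plane} (hb : Bornology.IsBounded C) (θ : Real.Angle)
    (l : ℝ) : chordLength C θ l ≤ longDiam C :=
  Metric.diam_mono (fun _ hx => hx.1) hb

theorem shortDiam_le_iSup (C : Set Plane) (θ : Real.Angle) :
    shortDiam C ≤ ⨆ l : {l : ℝ // 0 ≤ l}, chordLength C θ l := by
  refine ciInf_le (f := fun θ => ⨆ l : {l : ℝ // 0 ≤ l}, chordLength C θ l) ⟨0, ?_⟩ θ
  rintro _ ⟨φ, rfl⟩
  exact Real.iSup_nonneg fun l => Metric.diam_nonneg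

theorem shortDiam_le_longDiam {C : Set Plane} (hb : Bornology.IsBounded C) :
    shortDiam C ≤ longDiam C :=
  have : Nonempty {l : ℝ // 0 ≤ l} := ⟨⟨0, le_rfl⟩⟩
  (shortDiam_le_iSup C 0).trans (ciSup_le fun l => chordLength_le_longDiam hb 0 l)

/-- Chords in direction `perp θ` run parallel to `u θ`, so none is longer than the width in
direction `θ`. -/
theorem shortDiam_le_width {C : Set Plane} (hb : Bornology.IsBounded C) (hne : C.Nonempty)
    (θ : Real.Angle) : shortDiam C ≤ hi C θ - lo C θ := by
  have : Nonempty {l : ℝ // 0 ≤ l} := ⟨⟨0, le_rfl⟩⟩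
  obtain ⟨z, hz⟩ := hne
  refine (shortDiam_le_iSup C (perp θ)).trans (ciSup_le fun l => ?_)
  refine Metric.diam_le_of_forall_dist_le (by linarith [lo_le hb θ hz, le_hi hb θ hz]) ?_
  intro x hx y hy
  have h := norm_sq_eq θ (x - y)
  rw [inner_sub_left, inner_sub_left, hx.2, hy.2, sub_self, zero_pow two_ne_zero, add_zero] at h
  rw [dist_eq_norm, ← abs_of_nonneg (norm_nonneg (x - y)), (sq_eq_sq_iff_abs_eq_abs _ _).1 h, abs_le]
  exact ⟨by linarith [lo_le hb θ hx.1, le_hi hb θ hy.1],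
    by linarith [lo_le hb θ hy.1, le_hi hb θ hx.1]⟩

/-- A ball of radius `r` inside `C` gives, in every direction, a chord through its centre of length
at least `r / 2`. -/
theorem shortDiam_pos {C : Set Plane} (hC : IsConvexBody C) : 0 < shortDiam C := by
  obtain ⟨x, hx⟩ := hC.interior_nonempty
  obtain ⟨r, hr, hball⟩ := Metric.isOpen_iff.1 isOpen_interior x hx
  have hsub : Metric.ball x r ⊆ C := hball.trans interior_subset
  refine lt_of_lt_of_le (half_pos hr) (le_ciInf fun θ => ?_)
  have hxC := interior_subset hx
  have hl : 0 ≤ ⟪x, u θ⟫ - lo C θ := by linarith [lo_le hC.isBounded θ hxC]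
  have hbdd : BddAbove (range fun l : {l : ℝ // 0 ≤ l} => chordLength C θ l) :=
    ⟨longDiam C, by rintro _ ⟨l, rfl⟩; exact chordLength_le_longDiam hC.isBounded θ l⟩
  refine le_trans ?_ (le_ciSup hbdd ⟨_, hl⟩)
  have hy : x + (r / 2) • u (perp θ) ∈ C := hsub (by
    rw [Metric.mem_ball, dist_eq_norm, add_sub_cancel_left, norm_smul, norm_u, mul_one,
      Real.norm_of_nonneg (by linarith)]
    linarith)
  have h1 : x ∈ chord C θ (⟪x, u θ⟫ - lo C θ) := ⟨hxC, by rw [← lo]; ring⟩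
  have h2 : x + (r / 2) • u (perp θ) ∈ chord C θ (⟪x, u θ⟫ - lo C θ) := by
    refine ⟨hy, ?_⟩
    rw [← lo, inner_add_left, inner_smul_left, real_inner_comm (u θ) (u (perp θ)), inner_u_perp]
    ring
  have h3 := Metric.dist_le_diam_of_mem (hC.isBounded.subset fun _ h => h.1) h2 h1
  rw [dist_eq_norm, add_sub_cancel_left, norm_smul, norm_u, mul_one,
    Real.norm_of_nonneg (by linarith)] at h3
  exact h3

theorem gamma_eq_max_profile {C : Set Plane} {θ : Real.Angle} {l : ℝ} (hl : 0 < l)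
    (hlw : l < hi C θ - lo C θ) :
    gamma C θ l = max (profile C θ l) (profile C θ (hi C θ - lo C θ - l)) := by
  rw [gamma, chordLength_add_pi, profile_of_mem hl hlw,
    profile_of_mem (by linarith) (by linarith)]

end PlanarBody

end

/-! ### The two-sided estimate -/

theorem lemma3p1 :
    ∃ κ₃ κ₄ : ℝ, 0 < κ₃ ∧ 0 < κ₄ ∧
      ∀ C : Set PlanarBody.Plane, PlanarBody.IsConvexBody C →
        ∀ (θ : Real.Angle) (ρ : ℝ),
          κ₃ * PlanarBody.longDiam C ^ 6 / PlanarBody.shortDiam C ^ 7 ≤ ρ →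
            IntervalIntegrable
                (fun δ : ℝ => ‖PlanarBody.indicatorFourier (δ • C) (ρ • PlanarBody.u θ)‖ ^ 2)
                MeasureTheory.volume 0 1 ∧
              κ₄ * (ρ ^ 2)⁻¹ * PlanarBody.gamma C θ ρ⁻¹ ^ 2 ≤
                  ∫ δ in (0 : ℝ)..1,
                    ‖PlanarBody.indicatorFourier (δ • C) (ρ • PlanarBody.u θ)‖ ^ 2 ∧
                ∫ δ in (0 : ℝ)..1,
                    ‖PlanarBody.indicatorFourier (δ • C) (ρ • PlanarBody.u θ)‖ ^ 2 ≤
                  2 * (ρ ^ 2)⁻¹ * PlanarBody.gamma C θ ρ⁻¹ ^ 2 := by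
  refine ⟨10, (3 / 390625) ^ 2, by norm_num, by norm_num, fun C hC θ ρ hρC => ?_⟩
  have hS := PlanarBody.shortDiam_pos hC
  have hSL := PlanarBody.shortDiam_le_longDiam hC.isBounded
  have hSw := PlanarBody.shortDiam_le_width hC.isBounded
    (hC.interior_nonempty.mono interior_subset) θ
  have hf := PlanarBody.isConcaveProfile_profile hC θ
  -- Since the shortest diameter is at most the longest, the sixth powers only strengthen the
  -- hypothesis; `ρ ≥ 10 / S_C` is all that is used.
  have hρS : 10 / PlanarBody.shortDiam C ≤ ρ := by
    refine le_trans ?_ hρC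
    rw [div_le_div_iff₀ hS (by positivity)]
    calc 10 * PlanarBody.shortDiam C ^ 7
        = 10 * PlanarBody.shortDiam C ^ 6 * PlanarBody.shortDiam C := by ring
      _ ≤ 10 * PlanarBody.longDiam C ^ 6 * PlanarBody.shortDiam C := by gcongr
  have hρ : 0 < ρ := lt_of_lt_of_le (by positivity) hρS
  have hρw : 10 ≤ (PlanarBody.hi C θ - PlanarBody.lo C θ) * ρ := by
    rw [div_le_iff₀ hS] at hρS
    nlinarith
  have hlw : ρ⁻¹ < PlanarBody.hi C θ - PlanarBody.lo C θ := by
    rw [inv_lt_iff_one_lt_mul₀ hρ]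
    linarith
  -- The half-open interval omits `δ = 0`, where the scaling formula is not available.
  have heq : Set.EqOn
      (fun s : ℝ => (s ^ 2 * ‖PlanarBody.lineFourier (PlanarBody.profile C θ) (s * ρ)‖) ^ 2)
      (fun δ : ℝ => ‖PlanarBody.indicatorFourier (δ • C) (ρ • PlanarBody.u θ)‖ ^ 2)
      (Set.uIoc 0 1) := by
    intro δ hδ
    rw [Set.uIoc_of_le zero_le_one] at hδ
    simp only
    rw [PlanarBody.indicatorFourier_smul C hδ.1, smul_smul, norm_mul, norm_pow, Complex.norm_real,
      Real.norm_of_nonneg hδ.1.le, PlanarBody.norm_indicatorFourier_smul_u hC]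
  have hc := PlanarBody.continuous_lineFourier hf.integrable
  have hcont : Continuous fun s : ℝ =>
      (s ^ 2 * ‖PlanarBody.lineFourier (PlanarBody.profile C θ) (s * ρ)‖) ^ 2 := by fun_prop
  rw [PlanarBody.gamma_eq_max_profile (inv_pos.2 hρ) hlw,
    ← intervalIntegral.integral_congr_ae (Filter.Eventually.of_forall heq)]
  exact ⟨(hcont.intervalIntegrable 0 1).congr heq, hf.integral_bounds hρ hρw⟩
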